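/- Let $(X,d)$ be a complete metric space and $\mathbb R^+=[0,\infty)$. A process on $X$ is a family of maps $U(t,\tau):X\to X$, $(t,\tau)\in\mathbb R\times\mathbb R^+$, such that $U(t,0)x=x$, $U(t,\sigma+\tau)=U(t+\sigma,\tau)\circ U(t,\sigma)$, and $\tau\mapsto U(t,\tau)x$ is continuous on $\mathbb R^+$, for all $t\in\mathbb R$, $\sigma,\tau\in\mathbb R^+$, $x\in X$. Let $\omega>0$ and let $U$ be an $\omega$-periodic process, i.e. $U(t+\omega,\tau)=U(t,\tau)$ for all $(t,\tau)\in\mathbb R\times\mathbb R^+$, that is bounded, i.e. there is $M\ge 1$ with $d(U(0,\tau)x_1,U(0,\tau)x_2)\le M\,d(x_1,x_2)$ for all $\tau\in\mathbb R^+$ and $x_1,x_2\in X$. A set is relatively compact if its closure is compact. Then the following hold. (i) If $u:\mathbb R\to X$ is a complete trajectory of $U$, i.e. $u(t+\tau)=U(t,\tau)u(t)$ for all $(t,\tau)\in\mathbb R\times\mathbb R^+$, and $u(-\omega\mathbb N)=\{u(-n\omega):n\in\mathbb N\}$ is relatively compact, then $u$ is almost periodic: $u$ is continuous and for every $\varepsilon>0$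 there is $\ell>0$ such that every interval $[\alpha,\alpha+\ell]$, $\alpha\in\mathbb R$, contains some $\tau$ with $\sup_{t\in\mathbb R}d(u(t+\tau),u(t))\le\varepsilon$. (ii) If $u:\mathbb R^+\to X$ is a positive trajectory of $U$, i.e. $u=U(0,\cdot)x$ for some $x\in X$, and $u(\omega\mathbb N)=\{u(n\omega):n\in\mathbb N\}$ is relatively compact, then $u$ is asymptotically almost periodic: $u$ is continuous and there is an almost periodic function $v:\mathbb R\to X$ with $\lim_{t\to\infty}d(u(t),v(t))=0$. -/

import Mathlib

open scoped NNReal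

/-- A process (in the sense of Dafermos) on `X`: a two parameter family of maps
`U(t, τ) : X → X`, `(t, τ) ∈ ℝ × ℝ⁺`, with `U(t, 0) = id`,
`U(t, σ + τ) = U(t + σ, τ) ∘ U(t, σ)`, and `U(t, ·)x` continuous on `ℝ⁺`.
No continuity in `x` is required. -/
structure DafermosProcess (X : Type*) [TopologicalSpace X] where
  /-- The map `U(t, τ)`. -/
  map : ℝ → ℝ≥0 → X → X
  map_zero : ∀ (t : ℝ) (x : X), map t 0 x = x
  map_add : ∀ (t : ℝ) (σ τ : ℝ≥0) (x : X), map t (σ + τ) x = map (t + σ) τ (map t σ x)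
  continuous_map : ∀ (t : ℝ) (x : X), Continuous fun τ : ℝ≥0 => map t τ x

namespace DafermosProcess

/-- The process is `ω`-periodic: `ω > 0` and `U(t + ω, τ) = U(t, τ)`. -/
def IsPeriodic {X : Type*} [TopologicalSpace X] (U : DafermosProcess X) (ω : ℝ) : Prop :=
  0 < ω ∧ ∀ (t : ℝ) (τ : ℝ≥0), U.map (t + ω) τ = U.map t τ

/-- The process is bounded: for some `M ≥ 1`, all the maps `U(0, τ)` are `M`-Lipschitz. -/
def IsBounded {X : Type*} [MetricSpace X] (U : DafermosProcess X) : Prop :=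
  ∃ M : ℝ, 1 ≤ M ∧ ∀ (τ : ℝ≥0) (x₁ x₂ : X),
    dist (U.map 0 τ x₁) (U.map 0 τ x₂) ≤ M * dist x₁ x₂

/-- `u : ℝ → X` is a complete trajectory: `u(t + τ) = U(t, τ) u(t)`. -/
def IsCompleteTrajectory {X : Type*} [TopologicalSpace X] (U : DafermosProcess X)
    (u : ℝ → X) : Prop :=
  ∀ (t : ℝ) (τ : ℝ≥0), u (t + τ) = U.map t τ (u t)

/-- `u : ℝ⁺ → X` is a positive trajectory: `u = U(0, ·)x` for some `x`. -/
def IsPositiveTrajectory {X : Type*} [TopologicalSpace X] (U : DafermosProcess X)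
    (u : ℝ≥0 → X) : Prop :=
  ∃ x : X, u = fun τ => U.map 0 τ x

end DafermosProcess

/-- A set is relatively compact when its closure is compact. -/
def IsRelativelyCompact {X : Type*} [TopologicalSpace X] (s : Set X) : Prop :=
  IsCompact (closure s)

/-- `D ⊆ ℝ` is relatively dense: for some `ℓ > 0`, `D` meets every interval `[α, α + ℓ]`. -/
def IsRelativelyDense (D : Set ℝ) : Prop :=
  ∃ ℓ : ℝ, 0 < ℓ ∧ ∀ α : ℝ, (D ∩ Set.Icc α (α + ℓ)).Nonempty

/-- The set of `ε`-almost periods of `u`: the `τ` with `sup_t d(u(t + τ), u(t)) ≤ ε`. -/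
def almostPeriods {X : Type*} [MetricSpace X] (u : ℝ → X) (ε : ℝ) : Set ℝ :=
  {τ : ℝ | ∀ t : ℝ, dist (u (t + τ)) (u t) ≤ ε}

/-- Almost periodicity in the sense of Bohr. -/
def IsAlmostPeriodic {X : Type*} [MetricSpace X] (u : ℝ → X) : Prop :=
  Continuous u ∧ ∀ ε : ℝ, 0 < ε → IsRelativelyDense (almostPeriods u ε)

/-- `u : ℝ⁺ → X` is asymptotically almost periodic: it is continuous and
`d(u(t), v(t)) → 0` as `t → ∞` for some almost periodic `v : ℝ → X`. -/
def IsAsymptoticallyAlmostPeriodic {X : Type*} [MetricSpace X] (u : ℝ≥0 → X) : Prop :=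
  Continuous u ∧ ∃ v : ℝ → X, IsAlmostPeriodic v ∧
    Filter.Tendsto (fun t : ℝ≥0 => dist (u t) (v t)) Filter.atTop (nhds 0)

open Filter Topology

namespace DafermosProcess

variable {X : Type*}

/-! By periodicity every `U(nω, ·)` is `M`-Lipschitz, so closeness of two trajectories at time `nω`
persists afterwards up to the factor `M`. For (i), translates of `u` by multiples of `ω` are
compared by starting far in the past, inside the precompact set `u(-ωℕ)`; pigeonhole yields a finite
uniform net of translates (`exists_finset_translates`), hence Bohr's condition.

For (ii), an ultrafilter limit of translates of `u` is a complete trajectory `v`, almost periodic by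
(i). As `v 0` is a cluster point of `u(nω)`, `u` is eventually `δ`-close to a translate of `v`, for
every `δ`. These translates converge uniformly, and their limit is the required function. -/

theorem IsPeriodic.map_int_mul [TopologicalSpace X] {U : DafermosProcess X} {ω : ℝ}
    (h : U.IsPeriodic ω) (n : ℤ) : U.map (n * ω) = U.map 0 := by
  have hp : Function.Periodic U.map ω := fun t => funext fun τ => h.2 t τ
  exact hp.int_mul_eq n

/-- A complete trajectory is determined on `[nω, ∞)` by its value at `nω`. -/
theorem IsCompleteTrajectory.eq_map_int_mul [TopologicalSpace X] {U : DafermosProcess X} {ω : ℝ}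
    (h : U.IsPeriodic ω) {u : ℝ → X} (hu : U.IsCompleteTrajectory u) (n : ℤ) {t : ℝ}
    (ht : n * ω ≤ t) : u t = U.map 0 (t - n * ω).toNNReal (u (n * ω)) := by
  rw [← h.map_int_mul n, ← hu, Real.coe_toNNReal _ (by linarith)]
  congr 1
  ring

theorem IsCompleteTrajectory.continuous [TopologicalSpace X] {U : DafermosProcess X} {ω : ℝ}
    (h : U.IsPeriodic ω) {u : ℝ → X} (hu : U.IsCompleteTrajectory u) : Continuous u := by
  refine continuous_iff_continuousAt.2 fun t => ?_
  obtain ⟨n, hn⟩ := exists_int_lt (t / ω)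
  have hn' : n * ω < t := (lt_div_iff₀ h.1).1 hn
  have hc : Continuous fun s : ℝ => U.map 0 (s - n * ω).toNNReal (u (n * ω)) :=
    (U.continuous_map 0 _).comp (continuous_real_toNNReal.comp (by fun_prop))
  refine hc.continuousAt.congr ?_
  filter_upwards [lt_mem_nhds hn'] with s hs
  exact (hu.eq_map_int_mul h n hs.le).symm

/-- Finitely many translates of `u` by multiples of the period form an `ε`-net, in the uniform
distance, of all such translates. -/
theorem IsCompleteTrajectory.exists_finset_translates [MetricSpace X] {U : DafermosProcess X}
    {ω : ℝ} (h : U.IsPeriodic ω) (hb : U.IsBounded) {u : ℝ → X} (hu : U.IsCompleteTrajectory u)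
    (hK : TotallyBounded (u '' {t : ℝ | ∃ n : ℕ, t = -(ω * n)})) {ε : ℝ} (hε : 0 < ε) :
    ∃ F : Finset ℤ, ∀ k : ℤ, ∃ l ∈ F, ∀ t : ℝ, dist (u (t + k * ω)) (u (t + l * ω)) ≤ ε := by
  obtain ⟨M, hM, hL⟩ := hb
  have hM0 : 0 < M := by linarith
  by_contra! hcon
  -- Without a finite net there is an infinite `ε`-separated sequence of translates; `T` records
  -- times witnessing the separation.
  obtain ⟨f, hf⟩ := exists_seq_of_forall_finset_exists (fun _ : ℤ => True)
    (fun l k => ∃ t : ℝ, ε < dist (u (t + k * ω)) (u (t + l * ω)))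
    (fun F _ => (hcon F).imp fun k hk => ⟨trivial, fun l hl => hk l hl⟩)
  choose T hT using hf.2
  obtain ⟨C, hC, hcov⟩ := Metric.totallyBounded_iff.1 hK (ε / (2 * M)) (by positivity)
  set N := hC.toFinset.card
  have e1 : ∀ᶠ n : ℕ in atTop, ∀ i ∈ Finset.range (N + 1), f i ≤ (n : ℤ) :=
    (Finset.eventually_all _).2 fun i _ =>
      (tendsto_natCast_atTop_atTop (R := ℤ)).eventually_ge_atTop (f i)
  have e2 : ∀ᶠ n : ℕ in atTop, ∀ i ∈ Finset.range (N + 1), ∀ j ∈ Finset.range (N + 1),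
      ∀ hij : i < j, -(T i j hij) / ω ≤ (n : ℝ) := by
    refine (Finset.eventually_all _).2 fun i _ => (Finset.eventually_all _).2 fun j _ => ?_
    refine eventually_all.2 fun hij => ?_
    exact (tendsto_natCast_atTop_atTop (R := ℝ)).eventually_ge_atTop _
  -- One `n` serves all pairs among the first `N + 1` translates: the starting points `(f i - n)ω`
  -- lie in `-ωℕ`, and the elapsed times `T + nω` are nonnegative.
  obtain ⟨n, hn1, hn2⟩ := (e1.and e2).exists
  have hmem : ∀ i ∈ Finset.range (N + 1), ∃ c ∈ hC.toFinset,
      dist (u ((f i - n : ℤ) * ω)) c < ε / (2 * M) := by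
    intro i hi
    have hK' : u ((f i - n : ℤ) * ω) ∈ u '' {t : ℝ | ∃ n : ℕ, t = -(ω * n)} := by
      obtain ⟨p, hp⟩ := Int.eq_ofNat_of_zero_le (sub_nonneg.2 (hn1 i hi))
      refine ⟨_, ⟨p, ?_⟩, rfl⟩
      have hp' : ((n : ℤ) - f i : ℝ) = (p : ℝ) := by exact_mod_cast hp
      rw [← hp']
      push_cast
      ring
    obtain ⟨c, hc, hd⟩ := Set.mem_iUnion₂.1 (hcov hK')
    exact ⟨c, hC.mem_toFinset.2 hc, hd⟩
  have : Nonempty X := ⟨u 0⟩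
  choose! c hc hcd using hmem
  have key : ∀ i ∈ Finset.range (N + 1), ∀ j ∈ Finset.range (N + 1), i < j → c i ≠ c j := by
    intro i hi j hj hij hcc
    have h1 := hcd i hi
    have h2 := hcd j hj
    rw [← hcc] at h2
    have h3 : dist (u ((f j - n : ℤ) * ω)) (u ((f i - n : ℤ) * ω)) ≤ ε / M := by
      have := dist_triangle_right (u ((f j - n : ℤ) * ω)) (u ((f i - n : ℤ) * ω)) (c i)
      have h4 : ε / M = ε / (2 * M) + ε / (2 * M) := by field_simp; norm_num
      linarith
    have ht := (div_le_iff₀ h.1).1 (hn2 i hi j hj hij)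
    have h5 := hT i j hij
    have hg : ∀ m : ℤ, ((m - n : ℤ) : ℝ) * ω ≤ T i j hij + m * ω := by
      intro m
      push_cast
      linarith
    have hs : ∀ m : ℤ, T i j hij + m * ω - ((m - n : ℤ) : ℝ) * ω = T i j hij + n * ω := by
      intro m
      push_cast
      ring
    rw [hu.eq_map_int_mul h _ (hg (f j)), hu.eq_map_int_mul h _ (hg (f i)), hs, hs] at h5
    have h6 := hL (T i j hij + n * ω).toNNReal (u ((f j - n : ℤ) * ω)) (u ((f i - n : ℤ) * ω))
    have h7 := mul_le_mul_of_nonneg_left h3 hM0.le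
    rw [mul_div_cancel₀ _ hM0.ne'] at h7
    linarith
  obtain ⟨i, hi, j, hj, hij, hcc⟩ := Finset.exists_ne_map_eq_of_card_lt_of_maps_to
    (s := Finset.range (N + 1)) (t := hC.toFinset) (by simp [N]) hc
  rcases lt_or_gt_of_ne hij with hlt | hlt
  · exact key i hi j hj hlt hcc
  · exact key j hj i hi hlt hcc.symm

/-- If the translates by `kω` and `lω` are `ε`-close, then `(k - l)ω` is an `ε`-almost period;
finiteness of the net bounds `l`, hence the gaps. -/
theorem IsCompleteTrajectory.isAlmostPeriodic [MetricSpace X] {U : DafermosProcess X}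
    {ω : ℝ} (h : U.IsPeriodic ω) (hb : U.IsBounded) {u : ℝ → X} (hu : U.IsCompleteTrajectory u)
    (hK : TotallyBounded (u '' {t : ℝ | ∃ n : ℕ, t = -(ω * n)})) : IsAlmostPeriodic u := by
  refine ⟨hu.continuous h, fun ε hε => ?_⟩
  obtain ⟨F, hF⟩ := hu.exists_finset_translates h hb hK hε
  have hω := h.1
  obtain ⟨B, hB⟩ : ∃ B : ℕ, ∀ l ∈ F, |l| ≤ (B : ℤ) :=
    ⟨F.sup Int.natAbs, fun l hl => by
      rw [Int.abs_eq_natAbs]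
      exact_mod_cast Finset.le_sup (f := Int.natAbs) hl⟩
  -- `2B` covers the range of `l`, and `1` the rounding of `α / ω`.
  refine ⟨(2 * B + 1) * ω, by positivity, fun α => ?_⟩
  obtain ⟨l, hl, hd⟩ := hF (⌈α / ω⌉ + B)
  obtain ⟨hl1, hl2⟩ := abs_le.1 (hB l hl)
  have hl1' : -(B : ℝ) ≤ l := by exact_mod_cast hl1
  have hl2' : (l : ℝ) ≤ B := by exact_mod_cast hl2
  refine ⟨(⌈α / ω⌉ + B - l) * ω, fun t => ?_, ?_, ?_⟩
  · convert hd (t - l * ω) using 3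
    · push_cast
      ring
    · ring
  · rw [← div_le_iff₀ hω]
    linarith [Int.le_ceil (α / ω)]
  · have h1 : (⌈α / ω⌉ + B - l : ℝ) ≤ α / ω + (2 * B + 1) := by
      linarith [Int.ceil_lt_add_one (α / ω)]
    calc (⌈α / ω⌉ + B - l : ℝ) * ω ≤ (α / ω + (2 * B + 1)) * ω := by gcongr
      _ = α + (2 * B + 1) * ω := by field_simp

end DafermosProcess

section AlmostPeriodic

variable {X : Type*} [MetricSpace X]

/-- A bound for the distance of two translates of an almost periodic function near `+∞` holds
everywhere. -/
theorem IsAlmostPeriodic.dist_translate_le {v : ℝ → X} (hv : IsAlmostPeriodic v) {a b ε : ℝ}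
    (h : ∀ᶠ t in atTop, dist (v (t + a)) (v (t + b)) ≤ ε) (t : ℝ) :
    dist (v (t + a)) (v (t + b)) ≤ ε := by
  obtain ⟨T, hT⟩ := eventually_atTop.1 h
  refine le_of_forall_pos_le_add fun η hη => ?_
  obtain ⟨ℓ, -, hℓ⟩ := hv.2 (η / 2) (by positivity)
  -- An almost period carries `t` beyond `T`.
  obtain ⟨τ, hτ, hτT, -⟩ := hℓ (T - t)
  have h1 := hτ (t + a)
  have h2 := hτ (t + b)
  have h3 := hT (t + τ) (by linarith)
  rw [add_right_comm] at h1 h2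
  have h4 := dist_triangle4 (v (t + a)) (v (t + τ + a)) (v (t + τ + b)) (v (t + b))
  rw [dist_comm (v (t + a)) (v (t + τ + a))] at h4
  linarith

theorem IsAlmostPeriodic.translate {v : ℝ → X} (hv : IsAlmostPeriodic v) (c : ℝ) :
    IsAlmostPeriodic fun t => v (t + c) := by
  refine ⟨hv.1.comp (by fun_prop), fun ε hε => ?_⟩
  obtain ⟨ℓ, hℓ0, hℓ⟩ := hv.2 ε hε
  refine ⟨ℓ, hℓ0, fun α => (hℓ α).mono (Set.inter_subset_inter_left _ fun τ hτ t => ?_)⟩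
  simpa only [add_right_comm] using hτ (t + c)

theorem IsAlmostPeriodic.of_uniform_approx {w : ℝ → X}
    (h : ∀ δ : ℝ, 0 < δ → ∃ v : ℝ → X, IsAlmostPeriodic v ∧ ∀ t, dist (v t) (w t) ≤ δ) :
    IsAlmostPeriodic w := by
  constructor
  · refine continuous_of_uniform_approx_of_continuous fun s hs => ?_
    obtain ⟨ε, hε, hs⟩ := Metric.mem_uniformity_dist.1 hs
    obtain ⟨v, hv, hd⟩ := h (ε / 2) (by positivity)
    refine ⟨v, hv.1, fun t => hs ?_⟩
    rw [dist_comm]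
    linarith [hd t]
  · intro ε hε
    obtain ⟨v, hv, hd⟩ := h (ε / 3) (by positivity)
    obtain ⟨ℓ, hℓ0, hℓ⟩ := hv.2 (ε / 3) (by positivity)
    refine ⟨ℓ, hℓ0, fun α => (hℓ α).mono (Set.inter_subset_inter_left _ fun τ hτ t => ?_)⟩
    have h1 := dist_triangle4 (w (t + τ)) (v (t + τ)) (v t) (w t)
    rw [dist_comm (w (t + τ)) (v (t + τ))] at h1
    linarith [hd (t + τ), hd t, hτ t]

/-- If `u` is, up to arbitrarily small errors near `+∞`, a translate of an almost periodic
function, then it is asymptotic to an almost periodic function. -/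
theorem IsAlmostPeriodic.exists_tendsto_dist [CompleteSpace X] {v u : ℝ → X}
    (hv : IsAlmostPeriodic v)
    (h : ∀ δ : ℝ, 0 < δ → ∃ c : ℝ, ∀ᶠ t in atTop, dist (u t) (v (t + c)) ≤ δ) :
    ∃ w : ℝ → X, IsAlmostPeriodic w ∧ Tendsto (fun t => dist (u t) (w t)) atTop (𝓝 0) := by
  obtain ⟨δ, -, hδ0, hδ⟩ := exists_seq_strictAnti_tendsto (0 : ℝ)
  choose c hc using fun j => h (δ j) (hδ0 j)
  have hcc : ∀ j k t, dist (v (t + c j)) (v (t + c k)) ≤ δ j + δ k := fun j k =>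
    hv.dist_translate_le <| by
      filter_upwards [hc j, hc k] with t h1 h2
      linarith [dist_triangle_left (v (t + c j)) (v (t + c k)) (u t)]
  have hcauchy : ∀ t, CauchySeq fun j => v (t + c j) := by
    refine fun t => Metric.cauchySeq_iff.2 fun ε hε => ?_
    obtain ⟨N, hN⟩ := eventually_atTop.1 (hδ.eventually_lt_const (half_pos hε))
    exact ⟨N, fun j hj k hk => by linarith [hcc j k t, hN j hj, hN k hk]⟩
  choose w hw using fun t => cauchySeq_tendsto_of_complete (hcauchy t)
  have hvw : ∀ j t, dist (v (t + c j)) (w t) ≤ δ j := fun j t => by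
    have h1 : Tendsto (fun k => δ j + δ k) atTop (𝓝 (δ j)) := by simpa using hδ.const_add (δ j)
    exact le_of_tendsto_of_tendsto' (tendsto_const_nhds.dist (hw t)) h1 fun k => hcc j k t
  refine ⟨w, .of_uniform_approx fun ε hε => ?_, ?_⟩
  · obtain ⟨j, hj⟩ := (hδ.eventually_lt_const hε).exists
    exact ⟨_, hv.translate (c j), fun t => (hvw j t).trans hj.le⟩
  · refine Metric.tendsto_nhds.2 fun ε hε => ?_
    obtain ⟨j, hj⟩ := (hδ.eventually_lt_const (half_pos hε)).exists
    filter_upwards [hc j] with t ht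
    rw [Real.dist_0_eq_abs, abs_of_nonneg dist_nonneg]
    linarith [dist_triangle (u t) (v (t + c j)) (w t), hvw j t]

end AlmostPeriodic

namespace DafermosProcess

variable {X : Type*} [MetricSpace X]

theorem IsBounded.continuous_map_zero {U : DafermosProcess X} (hb : U.IsBounded) (τ : ℝ≥0) :
    Continuous (U.map 0 τ) := by
  obtain ⟨M, -, hL⟩ := hb
  exact (LipschitzWith.of_dist_le' (hL τ)).continuous

theorem IsPeriodic.map_zero_add {U : DafermosProcess X} {ω : ℝ} (h : U.IsPeriodic ω) (n : ℕ)
    {a : ℝ≥0} (ha : (a : ℝ) = n * ω) (τ : ℝ≥0) (x : X) :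
    U.map 0 (a + τ) x = U.map 0 τ (U.map 0 a x) := by
  rw [U.map_add, zero_add, ha]
  exact congrArg (fun g : ℝ≥0 → X → X => g τ _) (by simpa using h.map_int_mul n)

/-- If the points `U(0, nω)x` stay in a compact set, the translates of the positive trajectory of
`x` by multiples of `ω` accumulate at a complete trajectory. -/
theorem IsPeriodic.exists_completeTrajectory {U : DafermosProcess X} {ω : ℝ} (h : U.IsPeriodic ω)
    (hb : U.IsBounded) (x : X) {K : Set X} (hK : IsCompact K)
    (hxK : ∀ n : ℕ, U.map 0 (n * ω).toNNReal x ∈ K) :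
    ∃ v : ℝ → X, U.IsCompleteTrajectory v ∧ (∀ n : ℕ, v (-(ω * n)) ∈ K) ∧
      MapClusterPt (v 0) atTop fun n : ℕ => U.map 0 (n * ω).toNNReal x := by
  have hω := h.1
  -- The ultrafilter gives limits for all `m` at once, replacing a diagonal subsequence. Truncation
  -- in `q - m` is harmless, since eventually `q ≥ m`.
  let G : Ultrafilter ℕ := Ultrafilter.of atTop
  have hG : (G : Filter ℕ) ≤ atTop := Ultrafilter.of_le atTop
  have hz : ∀ m : ℕ, ∃ z ∈ K, Tendsto (fun q : ℕ => U.map 0 ((q - m : ℕ) * ω).toNNReal x) G (𝓝 z) :=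
    fun m => hK.ultrafilter_le_nhds' (G.map fun q : ℕ => U.map 0 ((q - m : ℕ) * ω).toNNReal x)
      (Ultrafilter.mem_map.2 (univ_mem' fun q => hxK (q - m)))
  choose z hzK hz using hz
  have hlim : ∀ (m : ℕ) (t : ℝ), -(ω * m) ≤ t →
      Tendsto (fun q : ℕ => U.map 0 (t + q * ω).toNNReal x) G
        (𝓝 (U.map 0 (t + ω * m).toNNReal (z m))) := by
    intro m t ht
    refine (((hb.continuous_map_zero _).tendsto _).comp (hz m)).congr' ?_
    filter_upwards [hG (eventually_ge_atTop m)] with q hq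
    have hq0 : (0 : ℝ) ≤ (q - m : ℕ) * ω := by positivity
    rw [Function.comp_apply, ← h.map_zero_add (q - m) (Real.coe_toNNReal _ hq0),
      ← Real.toNNReal_add hq0 (by linarith)]
    congr 2
    push_cast [hq]
    ring
  have hm : ∀ t : ℝ, ∃ m : ℕ, -(ω * m) ≤ t := fun t => by
    obtain ⟨m, hm⟩ := exists_nat_ge (-t / ω)
    exact ⟨m, by linarith [(div_le_iff₀ hω).1 hm]⟩
  choose m hm using hm
  let v : ℝ → X := fun t => U.map 0 (t + ω * m t).toNNReal (z (m t))
  -- The chosen starting index `m t` does not matter: both sides are limits of the same sequence.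
  have hv : ∀ (n : ℕ) (t : ℝ), -(ω * n) ≤ t → v t = U.map 0 (t + ω * n).toNNReal (z n) :=
    fun n t ht => tendsto_nhds_unique (hlim _ t (hm t)) (hlim n t ht)
  have hvz : ∀ n : ℕ, v (-(ω * n)) = z n := fun n => by
    rw [hv n _ le_rfl, neg_add_cancel, Real.toNNReal_zero, U.map_zero]
  refine ⟨v, fun t τ => ?_, fun n => hvz n ▸ hzK n, ?_⟩
  · have ht := hm t
    have h0 : 0 ≤ t + ω * m t := by linarith
    rw [hv (m t) (t + τ) (by linarith [τ.2]), hv (m t) t ht]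
    have hsum : (t + τ + ω * m t).toNNReal = (t + ω * m t).toNNReal + τ := by
      rw [add_right_comm, Real.toNNReal_add h0 τ.coe_nonneg, Real.toNNReal_coe]
    have hper : U.map (t + ω * m t) = U.map t := by
      have hp : Function.Periodic U.map ω := fun t => funext fun τ => h.2 t τ
      rw [mul_comm]
      exact hp.nat_mul (m t) t
    rw [hsum, U.map_add, zero_add, Real.coe_toNNReal _ h0, hper]
  · have h0 := hvz 0
    rw [Nat.cast_zero, mul_zero, neg_zero] at h0
    rw [h0]
    exact ((hz 0).mapClusterPt).mono hG

theorem IsPositiveTrajectory.isAsymptoticallyAlmostPeriodic [CompleteSpace X]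
    {U : DafermosProcess X} {ω : ℝ} (h : U.IsPeriodic ω) (hb : U.IsBounded) {u : ℝ≥0 → X}
    (hu : U.IsPositiveTrajectory u)
    (hK : IsRelativelyCompact (u '' {t : ℝ≥0 | ∃ n : ℕ, (t : ℝ) = ω * n})) :
    IsAsymptoticallyAlmostPeriodic u := by
  obtain ⟨x, rfl⟩ := hu
  have hω := h.1
  have hco : ∀ n : ℕ, (((n * ω).toNNReal : ℝ≥0) : ℝ) = n * ω := fun n =>
    Real.coe_toNNReal _ (by positivity)
  obtain ⟨v, hv, hvK, hv0⟩ := h.exists_completeTrajectory hb x hK fun n =>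
    subset_closure ⟨_, ⟨n, (hco n).trans (mul_comm _ _)⟩, rfl⟩
  have hvap : IsAlmostPeriodic v := by
    refine hv.isAlmostPeriodic h hb (hK.totallyBounded.subset ?_)
    rintro _ ⟨_, ⟨n, rfl⟩, rfl⟩
    exact hvK n
  refine ⟨U.continuous_map 0 x, ?_⟩
  have happrox : ∀ δ : ℝ, 0 < δ → ∃ c : ℝ, ∀ᶠ t : ℝ in atTop,
      dist (U.map 0 t.toNNReal x) (v (t + c)) ≤ δ := by
    intro δ hδ
    obtain ⟨M, hM, hL⟩ := hb
    have hM0 : 0 < M := by linarith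
    obtain ⟨n, hn⟩ := (hv0.frequently (Metric.ball_mem_nhds _ (div_pos hδ hM0))).exists
    refine ⟨-(n * ω), ?_⟩
    filter_upwards [eventually_ge_atTop (n * ω)] with t ht
    have ht0 : 0 ≤ t - n * ω := by linarith
    have e1 : U.map 0 t.toNNReal x
        = U.map 0 (t - n * ω).toNNReal (U.map 0 (n * ω).toNNReal x) := by
      rw [← h.map_zero_add n (hco n), ← Real.toNNReal_add (by positivity) ht0]
      congr 2
      ring
    have e2 : v (t + -(n * ω)) = U.map 0 (t - n * ω).toNNReal (v 0) := by
      rw [← hv, Real.coe_toNNReal _ ht0]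
      congr 1
      ring
    rw [e1, e2]
    refine (hL _ _ _).trans ?_
    rw [mul_comm]
    exact (le_div_iff₀ hM0).1 (Metric.mem_ball.1 hn).le
  obtain ⟨w, hw, hlim⟩ := hvap.exists_tendsto_dist happrox
  refine ⟨w, hw, (hlim.comp (NNReal.tendsto_coe_atTop.2 tendsto_id)).congr fun t => ?_⟩
  simp only [Function.comp_apply, id, Real.toNNReal_coe]

end DafermosProcess

theorem corollary4p3 {X : Type*} [MetricSpace X] [CompleteSpace X]
    (U : DafermosProcess X) (ω : ℝ) (hper : U.IsPeriodic ω) (hbdd : U.IsBounded) :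
    (∀ u : ℝ → X, U.IsCompleteTrajectory u →
      IsRelativelyCompact (u '' {t : ℝ | ∃ n : ℕ, t = -(ω * n)}) →
      IsAlmostPeriodic u) ∧
    (∀ u : ℝ≥0 → X, U.IsPositiveTrajectory u →
      IsRelativelyCompact (u '' {t : ℝ≥0 | ∃ n : ℕ, (t : ℝ) = ω * n}) →
      IsAsymptoticallyAlmostPeriodic u) :=
  ⟨fun _ hu hK => hu.isAlmostPeriodic hper hbdd (hK.totallyBounded.subset subset_closure),
    fun _ hu hK => hu.isAsymptoticallyAlmostPeriodic hper hbdd hK⟩
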